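/- For a real function $g$ and an interval $I$, a solution on $I$ of $\frac{d\eta}{du}=\frac{1}{\eta+g(u)}$ is a function $\eta$ with $\eta(u)+g(u)\neq 0$ and $\eta'(u)=\frac{1}{\eta(u)+g(u)}$ for all $u\in I$ (one-sided derivative at an endpoint belonging to $I$). (a) Let $p\ge 2$ be even. The equation $$\frac{d\eta}{du}=\frac{1}{\eta+u^p}$$ has a solution $\eta_0$ on $(-\infty,0]$ such that $$\eta_0(u)=-u^p-\frac1p\,\frac{1}{u^{p-1}}+O\!\left(\frac{1}{u^{3p-2}}\right),\qquad u\to-\infty,$$ and it is unique: for every $a\le 0$, every solution on $(-\infty,a]$ with this asymptotic expansion coincides with $\eta_0$ on $(-\infty,a]$. Moreover, there is a constant $K>\frac1p$ such that $$-u^p<\eta_0(u)\ \text{ for all } u\le 0,\qquad \eta_0(u)<-u^p-\frac{K}{u^{p-1}}\ \text{ for all } u<0 .$$ (b) Let $p\ge 3$ be odd. The equation $$\frac{d\eta}{du}=\frac{1}{\eta-u^p}$$ has a solution $\eta_0$ on $(-\infty,0]$ such that $$\eta_0(u)=u^p+\frac1p\,\frac{1}{u^{p-1}}+O\!\left(\frac{1}{u^{3p-2}}\right),\qquad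 u\to-\infty,$$ and it is unique: for every $a\le 0$, every solution on $(-\infty,a]$ with this asymptotic expansion coincides with $\eta_0$ on $(-\infty,a]$. Moreover, there is a constant $K>\frac1p$ such that $$u^p<\eta_0(u)\ \text{ for all } u\le 0,\qquad \eta_0(u)<u^p+\frac{K}{u^{p-1}}\ \text{ for all } u<0 .$$ -/

import Mathlib

open Filter Asymptotics

/-- `η` is a solution on the interval `s` of the scalar equation `dη/du = 1 / (η + g u)`.
The right-hand side has to make sense all along the solution, so `η u + g u ≠ 0` is required;
the derivative is one-sided at an endpoint of `s` that belongs to `s`. -/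
def IsSolutionOn (g : ℝ → ℝ) (s : Set ℝ) (η : ℝ → ℝ) : Prop :=
  ∀ u ∈ s, η u + g u ≠ 0 ∧ HasDerivWithinAt η (1 / (η u + g u)) s u

/-- `η u = -u^p - (1/p) / u^(p-1) + O(1 / u^(3p-2))` as `u → -∞`. -/
def HasEvenExpansion (p : ℕ) (η : ℝ → ℝ) : Prop :=
  (fun u : ℝ => η u - (-u ^ p - (1 / (p : ℝ)) * (1 / u ^ (p - 1))))
    =O[atBot] (fun u : ℝ => 1 / u ^ (3 * p - 2))

/-- `η u = u^p + (1/p) / u^(p-1) + O(1 / u^(3p-2))` as `u → -∞`. -/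
def HasOddExpansion (p : ℕ) (η : ℝ → ℝ) : Prop :=
  (fun u : ℝ => η u - (u ^ p + (1 / (p : ℝ)) * (1 / u ^ (p - 1))))
    =O[atBot] (fun u : ℝ => 1 / u ^ (3 * p - 2))

/-! With p = k + 2, both parities read dη/du = 1 / (η + (-u)^p), and y = η + (-u)^p satisfies y' =
1/y - p(-u)^(p-1). Two positive solutions attract each other: (y - z)' = -(y - z)/(yz), so |y - z|
is nonincreasing. If y - z tends to 0 at -∞, then y = z, which is uniqueness. For existence,
solutions are started at -N on the nullcline p(-u)^(p-1) y = 1. They stay below it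
(`nullcline_bound`), hence increase, and their relative gap to it is at most 1/(-u)^(2p-1)
(`nullcline_gap`). By contraction they are uniformly Cauchy on compact sets as N → ∞. Both bounds
pass to the limit and give the expansion and the inequalities. -/

/-- A function that is nonincreasing wherever it is positive stays nonpositive once it is so. -/
theorem nonpos_of_hasDerivWithinAt_nonpos_of_pos {φ φ' : ℝ → ℝ} {a b : ℝ}
    (hφ : ∀ x ∈ Set.Icc a b, HasDerivWithinAt φ (φ' x) (Set.Icc a b) x) (ha : φ a ≤ 0)
    (h : ∀ x ∈ Set.Icc a b, 0 < φ x → φ' x ≤ 0) : ∀ x ∈ Set.Icc a b, φ x ≤ 0 := by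
  intro c hc
  by_contra! hpos
  have hcont : ContinuousOn φ (Set.Icc a b) := fun x hx => (hφ x hx).continuousWithinAt
  have hcont' : ContinuousOn φ (Set.Icc a c) := hcont.mono (Set.Icc_subset_Icc_right hc.2)
  have hcomp : IsCompact (Set.Icc a c ∩ φ ⁻¹' Set.Iic 0) :=
    isCompact_Icc.of_isClosed_subset (hcont'.preimage_isClosed_of_isClosed isClosed_Icc isClosed_Iic)
      Set.inter_subset_left
  obtain ⟨s, ⟨⟨has, hsc⟩, hs0⟩, hs⟩ := hcomp.exists_isGreatest ⟨a, ⟨le_rfl, hc.1⟩, ha⟩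
  have hsub : Set.Icc s c ⊆ Set.Icc a b := Set.Icc_subset_Icc has hc.2
  have hanti : AntitoneOn φ (Set.Icc s c) := by
    refine antitoneOn_of_hasDerivWithinAt_nonpos (convex_Icc s c) (hcont.mono hsub)
      (f' := φ') (fun x hx => (hφ x (hsub (interior_subset hx))).mono
        (interior_subset.trans hsub)) (fun x hx => ?_)
    refine h x (hsub (interior_subset hx)) ?_
    rw [interior_Icc] at hx
    by_contra! hx0
    exact absurd (hs ⟨⟨has.trans hx.1.le, hx.2.le⟩, hx0⟩) (not_le.2 hx.1)
  have := hanti (Set.left_mem_Icc.2 hsc) (Set.right_mem_Icc.2 hsc) hsc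
  simp only [Set.mem_preimage, Set.mem_Iic] at hs0
  linarith

/-! ### The reduced equation and its contraction property -/

/-- `y` is a positive solution on `s` of `dy/du = 1 / y - (k + 2) (-u) ^ (k + 1)`, the equation
satisfied by `y u = η u + (-u) ^ (k + 2)` when `dη/du = 1 / (η + (-u) ^ (k + 2))`. -/
def IsReducedSolutionOn (k : ℕ) (s : Set ℝ) (y : ℝ → ℝ) : Prop :=
  ∀ u ∈ s, 0 < y u ∧ HasDerivWithinAt y (1 / y u - (k + 2) * (-u) ^ (k + 1)) s u

theorem IsReducedSolutionOn.mono {k : ℕ} {s t : Set ℝ} {y : ℝ → ℝ}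
    (hy : IsReducedSolutionOn k t y) (hst : s ⊆ t) : IsReducedSolutionOn k s y :=
  fun u hu => ⟨(hy u (hst hu)).1, (hy u (hst hu)).2.mono hst⟩

theorem IsReducedSolutionOn.continuousOn {k : ℕ} {s : Set ℝ} {y : ℝ → ℝ}
    (hy : IsReducedSolutionOn k s y) : ContinuousOn y s :=
  fun u hu => (hy u hu).2.continuousWithinAt

/-- Two positive solutions of the reduced equation approach each other. -/
theorem IsReducedSolutionOn.antitoneOn_sq_sub {k : ℕ} {s : Set ℝ} (hs : Convex ℝ s) {y z : ℝ → ℝ}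
    (hy : IsReducedSolutionOn k s y) (hz : IsReducedSolutionOn k s z) :
    AntitoneOn (fun u => (y u - z u) ^ 2) s := by
  refine antitoneOn_of_hasDerivWithinAt_nonpos hs ((hy.continuousOn.sub hz.continuousOn).pow 2)
    (f' := fun u => -2 * (y u - z u) ^ 2 / (y u * z u)) (fun u hu => ?_) (fun u hu => ?_)
  · have hu' := interior_subset hu
    refine ((((hy u hu').2.sub (hz u hu').2).pow 2).congr_deriv ?_).mono interior_subset
    have h1 := (hy u hu').1.ne'
    have h2 := (hz u hu').1.ne'
    simp only [Pi.sub_apply]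
    field_simp
    push_cast
    ring
  · have hu' := interior_subset hu
    have h1 := (hy u hu').1
    have h2 := (hz u hu').1
    refine div_nonpos_of_nonpos_of_nonneg ?_ (by positivity)
    nlinarith [sq_nonneg (y u - z u)]

theorem IsReducedSolutionOn.abs_sub_le {k : ℕ} {s : Set ℝ} (hs : Convex ℝ s) {y z : ℝ → ℝ}
    (hy : IsReducedSolutionOn k s y) (hz : IsReducedSolutionOn k s z) {u v : ℝ} (hu : u ∈ s)
    (hv : v ∈ s) (huv : u ≤ v) : |y v - z v| ≤ |y u - z u| :=
  sq_le_sq.1 (hy.antitoneOn_sq_sub hs hz hu hv huv)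

theorem hasDerivAt_neg_pow_succ (n : ℕ) (u : ℝ) :
    HasDerivAt (fun u : ℝ => (-u) ^ (n + 1)) (-((n + 1) * (-u) ^ n)) u := by
  refine ((hasDerivAt_id u).neg.pow (n + 1)).congr_deriv ?_
  simp

/-! ### Barriers along the nullcline -/

/-- A solution starting on or below the nullcline stays there. -/
theorem IsReducedSolutionOn.nullcline_bound {k : ℕ} {N : ℝ} {y : ℝ → ℝ}
    (hy : IsReducedSolutionOn k (Set.Icc (-N) 0) y) (h0 : (k + 2) * N ^ (k + 1) * y (-N) ≤ 1) :
    ∀ u ∈ Set.Icc (-N) 0, (k + 2) * (-u) ^ (k + 1) * y u ≤ 1 := by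
  have key := nonpos_of_hasDerivWithinAt_nonpos_of_pos
    (φ := fun u => (k + 2) * (-u) ^ (k + 1) * y u - 1)
    (φ' := fun u => (k + 2) * -((k + 1) * (-u) ^ k) * y u +
      (k + 2) * (-u) ^ (k + 1) * (1 / y u - (k + 2) * (-u) ^ (k + 1))) (a := -N) (b := 0)
    (fun u hu => ?_) (by simpa using h0) (fun u hu hpos => ?_)
  · exact fun u hu => by linarith [key u hu]
  · exact ((((hasDerivAt_neg_pow_succ k u).const_mul ((k : ℝ) + 2)).hasDerivWithinAt).mul
      (hy u hu).2).sub_const 1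
  · have hy0 := (hy u hu).1
    have ht : 0 ≤ -u := by linarith [hu.2]
    have h1 : 1 / y u - (k + 2) * (-u) ^ (k + 1) ≤ 0 := by
      rw [sub_nonpos, div_le_iff₀ hy0]
      linarith
    have h2 : 0 ≤ ((k : ℝ) + 2) * (-u) ^ (k + 1) := by positivity
    have h3 : 0 ≤ ((k : ℝ) + 2) * ((k + 1) * (-u) ^ k) * y u := by positivity
    nlinarith [mul_nonneg h2 (neg_nonneg.2 h1)]

/-- Solutions below the nullcline are nondecreasing. -/
theorem IsReducedSolutionOn.monotoneOn {k : ℕ} {s : Set ℝ} (hs : Convex ℝ s) {y : ℝ → ℝ}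
    (hy : IsReducedSolutionOn k s y) (h : ∀ u ∈ s, (k + 2) * (-u) ^ (k + 1) * y u ≤ 1) :
    MonotoneOn y s := by
  refine monotoneOn_of_hasDerivWithinAt_nonneg hs hy.continuousOn
    (fun u hu => (hy u (interior_subset hu)).2.mono interior_subset) (fun u hu => ?_)
  rw [sub_nonneg, le_div_iff₀ (hy u (interior_subset hu)).1]
  exact h u (interior_subset hu)

/-- A solution starting on the nullcline stays close to it. -/
theorem IsReducedSolutionOn.nullcline_gap {k : ℕ} {N : ℝ} {y : ℝ → ℝ}
    (hy : IsReducedSolutionOn k (Set.Icc (-N) 0) y) (h0 : (k + 2) * N ^ (k + 1) * y (-N) = 1) :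
    ∀ u ∈ Set.Icc (-N) 0,
      (1 - (k + 2) * (-u) ^ (k + 1) * y u) * (-u) ^ (2 * k + 3) ≤ 1 := by
  have hle := hy.nullcline_bound h0.le
  have key := nonpos_of_hasDerivWithinAt_nonpos_of_pos
    (φ := fun u => (1 - (k + 2) * (-u) ^ (k + 1) * y u) * (-u) ^ (2 * k + 3) - 1)
    (φ' := fun u => -((k + 2) * -((k + 1) * (-u) ^ k) * y u +
      (k + 2) * (-u) ^ (k + 1) * (1 / y u - (k + 2) * (-u) ^ (k + 1))) * (-u) ^ (2 * k + 3) +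
      (1 - (k + 2) * (-u) ^ (k + 1) * y u) * -((2 * k + 3) * (-u) ^ (2 * k + 2)))
    (a := -N) (b := 0) (fun u hu => ?_) (by simp [h0]) (fun u hu hpos => ?_)
  · exact fun u hu => by linarith [key u hu]
  · have h1 := ((((hasDerivAt_neg_pow_succ k u).const_mul ((k : ℝ) + 2)).hasDerivWithinAt).mul
      (hy u hu).2).const_sub 1
    have h2 := (hasDerivAt_neg_pow_succ (2 * k + 2) u).hasDerivWithinAt (s := Set.Icc (-N) 0)
    refine ((h1.mul h2).sub_const 1).congr_deriv ?_
    push_cast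
    simp only [Pi.mul_apply]
    ring
  · have hy0 := (hy u hu).1
    have hh := hle u hu
    have ht : 0 ≤ -u := by linarith [hu.2]
    beta_reduce at hpos
    generalize hY : y u = Y at *
    generalize -u = t at *
    have hgap : 0 ≤ 1 - (k + 2) * t ^ (k + 1) * Y := by linarith
    have h1 : ((k : ℝ) + 2) * t ^ (k + 1) * (1 / Y - (k + 2) * t ^ (k + 1)) =
        (k + 2) * t ^ k * (t * (1 - (k + 2) * t ^ (k + 1) * Y)) / Y := by
      field_simp
      ring
    -- Below the nullcline (k+2) t^(k+1) Y ≤ 1; squaring and using k + 1 ≤ (k+2)² gives this.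
    have h2 : (k + 1) * Y ^ 2 * t ^ (2 * k + 2) ≤ 1 := by
      have h4 : ((k + 2) * t ^ (k + 1) * Y) ^ 2 ≤ 1 := by
        apply pow_le_one₀ (by positivity) hh
      have h5 : ((k + 2) * t ^ (k + 1) * Y) ^ 2 = (k + 2) ^ 2 * (Y ^ 2 * t ^ (2 * k + 2)) := by
        ring
      have h6 : 0 ≤ Y ^ 2 * t ^ (2 * k + 2) := by positivity
      have hk : (0 : ℝ) ≤ k := k.cast_nonneg
      nlinarith [mul_nonneg hk h6, mul_nonneg (mul_nonneg hk hk) h6]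
    have htpos : 0 < t := by
      rcases ht.eq_or_lt with h | h
      · rw [← h] at hpos
        simp at hpos
        linarith
      · exact h
    -- Where the bound fails the gap exceeds t^-(2k+3), so the pull towards the nullcline beats the
    -- nullcline's own motion.
    have h3 : (k + 1) * Y ^ 2 ≤ t * (1 - (k + 2) * t ^ (k + 1) * Y) := by
      have h4 : 0 < t ^ (2 * k + 2) := by positivity
      refine le_of_mul_le_mul_right ?_ h4
      have h5 : t * (1 - (k + 2) * t ^ (k + 1) * Y) * t ^ (2 * k + 2) =
        (1 - (k + 2) * t ^ (k + 1) * Y) * t ^ (2 * k + 3) := by ring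
      linarith
    have h4 : (k + 2) * ((k + 1) * t ^ k) * Y ≤
        (k + 2) * t ^ k * (t * (1 - (k + 2) * t ^ (k + 1) * Y)) / Y := by
      rw [le_div_iff₀ hy0]
      have : 0 ≤ ((k : ℝ) + 2) * t ^ k := by positivity
      nlinarith [mul_le_mul_of_nonneg_left h3 this]
    rw [h1]
    have h5 : 0 ≤ (1 - (k + 2) * t ^ (k + 1) * Y) * ((2 * k + 3) * t ^ (2 * k + 2)) := by
      positivity
    have h6 : 0 ≤ t ^ (2 * k + 3) := by positivity
    nlinarith [mul_nonneg (sub_nonneg.2 h4) h6]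

/-! ### Existence on compact intervals and passage to the limit -/

/-- The solution starting on the nullcline at `-N` exists up to `0`. -/
theorem exists_isReducedSolutionOn_Icc (k : ℕ) {N : ℝ} (hN : 0 < N) :
    ∃ y : ℝ → ℝ, IsReducedSolutionOn k (Set.Icc (-N) 0) y ∧
      (k + 2) * N ^ (k + 1) * y (-N) = 1 := by
  set A : ℝ := (k + 2) * N ^ (k + 1) with hA
  have hA0 : 0 < A := by positivity
  have hmax : ∀ x : ℝ, 0 < max x (1 / A) := fun x => lt_max_of_lt_right (by positivity)
  have hinv : ∀ x : ℝ, 1 / max x (1 / A) ≤ A := fun x => by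
    rw [div_le_iff₀ (hmax x)]
    calc (1 : ℝ) = A * (1 / A) := by field_simp
      _ ≤ _ := by gcongr; exact le_max_right _ _
  have hr : ∀ t ∈ Set.Icc (-N) 0, 0 ≤ (k + 2) * (-t) ^ (k + 1) ∧
      (k + 2) * (-t) ^ (k + 1) ≤ A := fun t ht => by
    have h1 : 0 ≤ -t := by linarith [ht.2]
    refine ⟨by positivity, ?_⟩
    rw [hA]
    gcongr
    linarith [ht.1]
  -- Truncating y below at 1/A, its initial value, makes the field globally Lipschitz and bounded by
  -- A, so the radius A * N covers the whole interval.
  have hPL : IsPicardLindelof (fun t x : ℝ => 1 / max x (1 / A) - (k + 2) * (-t) ^ (k + 1))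
      (⟨-N, by simp [hN.le]⟩ : Set.Icc (-N) 0) (1 / A) (A * N).toNNReal 0
      A.toNNReal (A * A).toNNReal := by
    refine ⟨fun t _ => ?_, fun x _ => ?_, fun t ht x _ => ?_, ?_⟩
    · refine LipschitzWith.lipschitzOnWith (LipschitzWith.of_dist_le_mul fun x z => ?_)
      rw [Real.coe_toNNReal _ (by positivity)]
      simp only [Real.dist_eq, sub_sub_sub_cancel_right]
      have h1 := hmax x
      have h2 := hmax z
      have h3 : 1 / max x (1 / A) - 1 / max z (1 / A) =
          (1 / max x (1 / A) * (1 / max z (1 / A))) * (max z (1 / A) - max x (1 / A)) := by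
        field_simp
      rw [h3, abs_mul, abs_of_pos (by positivity)]
      have h4 : |max z (1 / A) - max x (1 / A)| ≤ |x - z| := by
        rw [abs_sub_comm x z]
        exact abs_max_sub_max_le_abs _ _ _
      exact mul_le_mul (mul_le_mul (hinv x) (hinv z) (by positivity) hA0.le) h4 (abs_nonneg _)
        (by positivity)
    · fun_prop
    · have h1 := hinv x
      have h2 : 0 < 1 / max x (1 / A) := by have := hmax x; positivity
      obtain ⟨h3, h4⟩ := hr t ht
      rw [Real.norm_eq_abs, abs_le, Real.coe_toNNReal _ hA0.le]
      constructor <;> linarith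
    · rw [Real.coe_toNNReal _ hA0.le, Real.coe_toNNReal _ (by positivity)]
      simp [hN.le]
  obtain ⟨y, hy0, hy⟩ := hPL.exists_eq_forall_mem_Icc_hasDerivWithinAt₀
  simp only at hy0
  -- The truncation is never active: below 1/A the slope is A - (k+2)(-u)^(k+1) ≥ 0.
  have key := nonpos_of_hasDerivWithinAt_nonpos_of_pos (φ := fun u => 1 / A - y u)
    (φ' := fun u => -(1 / max (y u) (1 / A) - (k + 2) * (-u) ^ (k + 1))) (a := -N) (b := 0)
    (fun u hu => (hy u hu).const_sub _) (by simp [hy0]) (fun u hu hpos => ?_)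
  · refine ⟨y, fun u hu => ?_, by rw [hy0]; field_simp⟩
    have h1 : 1 / A ≤ y u := by linarith [key u hu]
    refine ⟨lt_of_lt_of_le (by positivity) h1, ?_⟩
    have := hy u hu
    rwa [max_eq_left h1] at this
  · rw [max_eq_right (by linarith), one_div_one_div]
    linarith [(hr u hu).2]

/-- A cruder form of the nullcline bound, free of k, that supplies the Cauchy rate 1/(n+1). -/
theorem IsReducedSolutionOn.mul_neg_le_one {k : ℕ} {N u : ℝ} {y : ℝ → ℝ}
    (hy : IsReducedSolutionOn k (Set.Icc (-N) 0) y) (h0 : (k + 2) * N ^ (k + 1) * y (-N) ≤ 1)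
    (hu : u ∈ Set.Icc (-N) 0) (hu1 : u ≤ -1) : -u * y u ≤ 1 := by
  refine le_trans ?_ (hy.nullcline_bound h0 u hu)
  refine mul_le_mul_of_nonneg_right ?_ (hy u hu).1.le
  have h1 : -u ≤ (-u) ^ (k + 1) := le_self_pow₀ (by linarith) (by omega)
  have hk : (0 : ℝ) ≤ k := k.cast_nonneg
  nlinarith [mul_nonneg hk (show 0 ≤ (-u) ^ (k + 1) by linarith)]

/-- Solutions starting on the nullcline far to the left are bounded below on compact intervals. -/
theorem IsReducedSolutionOn.lower_bound {k : ℕ} {N T : ℝ} {y : ℝ → ℝ}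
    (hy : IsReducedSolutionOn k (Set.Icc (-N) 0) y) (h0 : (k + 2) * N ^ (k + 1) * y (-N) = 1)
    (hT : 2 ≤ T) (hTN : T ≤ N) :
    ∀ u ∈ Set.Icc (-T) 0, 1 / (2 * ((k + 2) * T ^ (k + 1))) ≤ y u := by
  intro u hu
  have hmem : -T ∈ Set.Icc (-N) 0 := ⟨by linarith, by linarith⟩
  refine le_trans ?_ (hy.monotoneOn (convex_Icc _ _) (hy.nullcline_bound h0.le) hmem
    ⟨by linarith [hu.1], hu.2⟩ hu.1)
  -- As T ≥ 2, the relative gap at -T is at most 1/2; monotonicity carries the bound from -T to the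
  -- right.
  have hgap := hy.nullcline_gap h0 (-T) hmem
  have hle := hy.nullcline_bound h0.le (-T) hmem
  rw [neg_neg] at hgap hle
  have h1 : T ≤ T ^ (2 * k + 3) := le_self_pow₀ (by linarith) (by omega)
  have hT0 : 0 < T := by linarith
  rw [div_le_iff₀ (by positivity)]
  nlinarith [mul_le_mul_of_nonneg_left (hT.trans h1) (sub_nonneg.2 hle)]

/-- A locally uniform limit of reduced solutions is a reduced solution. -/
theorem isReducedSolutionOn_Iic_of_tendstoUniformlyOn {k : ℕ} {Y : ℕ → ℝ → ℝ} {y : ℝ → ℝ}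
    (hY : ∀ T : ℝ, ∀ᶠ n in atTop, IsReducedSolutionOn k (Set.Icc (-T) 0) (Y n))
    (hlow : ∀ T : ℝ, ∃ c : ℝ, 0 < c ∧ ∀ᶠ n in atTop, ∀ u ∈ Set.Icc (-T) 0, c ≤ Y n u)
    (hlim : ∀ T : ℝ, TendstoUniformlyOn Y y atTop (Set.Icc (-T) 0)) :
    IsReducedSolutionOn k (Set.Iic 0) y := by
  have hlow' : ∀ T : ℝ, ∃ c : ℝ, 0 < c ∧ (∀ᶠ n in atTop, ∀ u ∈ Set.Icc (-T) 0, c ≤ Y n u) ∧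
      ∀ u ∈ Set.Icc (-T) 0, c ≤ y u := fun T => by
    obtain ⟨c, hc, h⟩ := hlow T
    exact ⟨c, hc, h, fun u hu => ge_of_tendsto ((hlim T).tendsto_at hu)
      (h.mono fun n hn => hn u hu)⟩
  have hcont : ∀ T : ℝ, ContinuousOn y (Set.Icc (-T) 0) := fun T =>
    (hlim T).continuousOn ((hY T).mono fun n hn => hn.continuousOn).frequently
  have hpos : ∀ u ≤ 0, 0 < y u := fun u hu => by
    obtain ⟨c, hc, -, h⟩ := hlow' (-u)
    exact hc.trans_le (h u ⟨by simp, hu⟩)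
  have hder : ∀ u < 0, HasDerivAt y (1 / y u - (k + 2) * (-u) ^ (k + 1)) u := fun u hu => by
    obtain ⟨c, hc, hcY, hcy⟩ := hlow' (1 - u)
    have hsub : Set.Ioo (-(1 - u)) 0 ⊆ Set.Icc (-(1 - u)) 0 := Set.Ioo_subset_Icc_self
    refine hasDerivAt_of_tendstoUniformlyOn (l := atTop) (s := Set.Ioo (-(1 - u)) 0) isOpen_Ioo
      (f := Y) (f' := fun n u => 1 / Y n u - (k + 2) * (-u) ^ (k + 1))
      (g' := fun u => 1 / y u - (k + 2) * (-u) ^ (k + 1)) ?_ ?_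
      (fun x hx => (hlim _).tendsto_at (hsub hx)) ⟨by linarith, hu⟩
    · rw [Metric.tendstoUniformlyOn_iff]
      intro ε hε
      filter_upwards [hcY, Metric.tendstoUniformlyOn_iff.1 (hlim (1 - u)) (ε * (c * c))
        (by positivity)] with n hn1 hn2 x hx
      have h1 := hn1 x (hsub hx)
      have h2 := hcy x (hsub hx)
      have h3 := hn2 x (hsub hx)
      have h1' := hc.trans_le h1
      have h2' := hc.trans_le h2
      rw [Real.dist_eq] at h3 ⊢
      have h4 : 1 / y x - (k + 2) * (-x) ^ (k + 1) - (1 / Y n x - (k + 2) * (-x) ^ (k + 1)) =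
          (Y n x - y x) / (y x * Y n x) := by
        field_simp
        ring
      rw [h4, abs_div, abs_of_pos (mul_pos h2' h1'), div_lt_iff₀ (by positivity), abs_sub_comm]
      refine h3.trans_le ?_
      gcongr
    · filter_upwards [hY (1 - u)] with n hn x hx
      exact (hn x (hsub hx)).2.hasDerivAt (Icc_mem_nhds hx.1 hx.2)
  intro u hu
  refine ⟨hpos u hu, ?_⟩
  rcases (Set.mem_Iic.1 hu).lt_or_eq with hu0 | rfl
  · exact (hder u hu0).hasDerivWithinAt
  · have hc0 : ContinuousWithinAt y (Set.Iio 0) 0 :=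
      ((hcont 1) 0 (by simp)).mono_of_mem_nhdsWithin
        (mem_of_superset (Ico_mem_nhdsLT (by norm_num : (-1 : ℝ) < 0)) Set.Ico_subset_Icc_self)
    -- At the endpoint 0 the one-sided derivative is the limit of the interior derivatives.
    refine hasDerivWithinAt_Iic_of_tendsto_deriv (s := Set.Iio 0)
      (fun x hx => (hder x hx).differentiableAt.differentiableWithinAt) hc0
      self_mem_nhdsWithin ?_
    have h1 : Tendsto (fun x => 1 / y x - (k + 2) * (-x) ^ (k + 1)) (nhdsWithin 0 (Set.Iio 0))
        (nhds (1 / y 0 - (k + 2) * (-0) ^ (k + 1))) := by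
      refine (tendsto_const_nhds.div hc0 (hpos 0 le_rfl).ne').sub ?_
      exact (by fun_prop : Continuous fun x : ℝ => ((k : ℝ) + 2) * (-x) ^ (k + 1)).continuousAt.mono_left
        nhdsWithin_le_nhds
    refine h1.congr' ?_
    filter_upwards [self_mem_nhdsWithin] with x hx
    exact (hder x hx).deriv.symm

/-- The reduced equation has a global positive solution which follows the nullcline. -/
theorem exists_isReducedSolutionOn_Iic (k : ℕ) :
    ∃ y : ℝ → ℝ, IsReducedSolutionOn k (Set.Iic 0) y ∧
      (∀ u ≤ 0, (k + 2) * (-u) ^ (k + 1) * y u ≤ 1) ∧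
      ∀ u ≤ 0, (1 - (k + 2) * (-u) ^ (k + 1) * y u) * (-u) ^ (2 * k + 3) ≤ 1 := by
  choose Y hY hY0 using fun n : ℕ =>
    exists_isReducedSolutionOn_Icc k (N := (n : ℝ) + 1) (by positivity)
  have hev : ∀ T : ℝ, ∀ᶠ n : ℕ in atTop, T ≤ (n : ℝ) + 1 := fun T => by
    filter_upwards [eventually_ge_atTop ⌈T⌉₊] with n hn
    linarith [Nat.ceil_le.1 hn]
  have hev' : ∀ ε > 0, ∀ᶠ n : ℕ in atTop, 1 / ((n : ℝ) + 1) < ε := fun ε hε =>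
    tendsto_one_div_add_atTop_nhds_zero_nat.eventually (gt_mem_nhds hε)
  have hdist : ∀ n m : ℕ, n ≤ m → ∀ u ∈ Set.Icc (-((n : ℝ) + 1)) 0,
      |Y m u - Y n u| ≤ 1 / ((n : ℝ) + 1) := fun n m hnm u hu => by
    have hn : (0 : ℝ) ≤ n := n.cast_nonneg
    have hnm' : (n : ℝ) ≤ m := by exact_mod_cast hnm
    have hmem : -((n : ℝ) + 1) ∈ Set.Icc (-((n : ℝ) + 1)) 0 := ⟨le_rfl, by linarith⟩
    have hsub : Set.Icc (-((n : ℝ) + 1)) 0 ⊆ Set.Icc (-((m : ℝ) + 1)) 0 :=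
      Set.Icc_subset_Icc_left (by linarith)
    -- At -(n+1) both solutions lie in (0, 1/(n+1)], and contraction propagates this to the right.
    refine (((hY m).mono hsub).abs_sub_le (convex_Icc _ _) (hY n) hmem hu hu.1).trans ?_
    have h1 := (hY n).mul_neg_le_one (hY0 n).le hmem (by linarith)
    have h2 := (hY m).mul_neg_le_one (hY0 m).le (hsub hmem) (by linarith)
    rw [neg_neg, mul_comm, ← le_div_iff₀ (by positivity)] at h1 h2
    have h3 := (hY n _ hmem).1
    have h4 := (hY m _ (hsub hmem)).1
    rw [abs_le]
    constructor <;> linarith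
  have hex : ∀ u : ℝ, ∃ l : ℝ, u ≤ 0 → Tendsto (fun n => Y n u) atTop (nhds l) := fun u => by
    by_cases hu : u ≤ 0
    · have hC : CauchySeq fun n => Y n u := by
        rw [Metric.cauchySeq_iff']
        intro ε hε
        obtain ⟨N, hN1, hN2⟩ := ((hev (-u)).and (hev' ε hε)).exists
        exact ⟨N, fun n hn => (hdist N n hn u ⟨by linarith, hu⟩).trans_lt hN2⟩
      obtain ⟨l, hl⟩ := cauchySeq_tendsto_of_complete hC
      exact ⟨l, fun _ => hl⟩
    · exact ⟨0, fun h => absurd h hu⟩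
  choose y hy using hex
  have hlim : ∀ T : ℝ, TendstoUniformlyOn Y y atTop (Set.Icc (-T) 0) := fun T => by
    rw [Metric.tendstoUniformlyOn_iff]
    intro ε hε
    filter_upwards [hev T, hev' ε hε] with n hn1 hn2 u hu
    refine lt_of_le_of_lt ?_ hn2
    refine le_of_tendsto ((hy u hu.2).dist tendsto_const_nhds) ?_
    filter_upwards [eventually_ge_atTop n] with m hm
    exact hdist n m hm u ⟨by linarith [hu.1], hu.2⟩
  refine ⟨y, isReducedSolutionOn_Iic_of_tendstoUniformlyOn (Y := Y) (fun T => ?_) (fun T => ?_)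
    hlim, fun u hu => ?_, fun u hu => ?_⟩
  · filter_upwards [hev T] with n hn
    exact (hY n).mono (Set.Icc_subset_Icc_left (by linarith))
  · have hT : 0 < max 2 T := lt_max_of_lt_left two_pos
    refine ⟨1 / (2 * ((k + 2) * (max 2 T) ^ (k + 1))), by positivity, ?_⟩
    filter_upwards [hev (max 2 T)] with n hn u hu
    exact (hY n).lower_bound (hY0 n) (le_max_left _ _) hn u
      ⟨by linarith [hu.1, le_max_right 2 T], hu.2⟩
  · refine le_of_tendsto ((hy u hu).const_mul _) ?_
    filter_upwards [hev (-u)] with n hn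
    exact (hY n).nullcline_bound (hY0 n).le u ⟨by linarith, hu⟩
  · refine le_of_tendsto ((((hy u hu).const_mul _).const_sub 1).mul_const _) ?_
    filter_upwards [hev (-u)] with n hn
    exact (hY n).nullcline_gap (hY0 n) u ⟨by linarith, hu⟩

/-! ### Uniqueness and the expansion at -∞ -/

/-- Positive solutions that are asymptotic to each other at `-∞` coincide. -/
theorem IsReducedSolutionOn.eqOn {k : ℕ} {a : ℝ} {y z : ℝ → ℝ}
    (hy : IsReducedSolutionOn k (Set.Iic a) y) (hz : IsReducedSolutionOn k (Set.Iic a) z)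
    (h : Tendsto (fun u => y u - z u) atBot (nhds 0)) : Set.EqOn y z (Set.Iic a) := by
  intro u hu
  have h0 : |y u - z u| ≤ 0 := by
    refine ge_of_tendsto (x := atBot) (f := fun v => |y v - z v|) (by simpa using h.abs) ?_
    filter_upwards [eventually_le_atBot u] with v hv
    exact hy.abs_sub_le (convex_Iic a) hz (hv.trans hu) hu hv
  exact sub_eq_zero.1 (abs_eq_zero.1 (le_antisymm h0 (abs_nonneg _)))

/-- The expansion `y u = (1 / (k + 2)) / (-u) ^ (k + 1) + O(1 / u ^ (3 * k + 4))` as `u → -∞`. -/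
def HasNullclineExpansion (k : ℕ) (y : ℝ → ℝ) : Prop :=
  (fun u : ℝ => y u - 1 / ((k : ℝ) + 2) * (1 / (-u) ^ (k + 1)))
    =O[atBot] (fun u : ℝ => 1 / (-u) ^ (3 * k + 4))

theorem tendsto_one_div_neg_pow_atBot {n : ℕ} (hn : n ≠ 0) :
    Tendsto (fun u : ℝ => 1 / (-u) ^ n) atBot (nhds 0) := by
  simp only [one_div]
  exact tendsto_inv_atTop_zero.comp ((tendsto_pow_atTop hn).comp tendsto_neg_atBot_atTop)

theorem HasNullclineExpansion.tendsto {k : ℕ} {y : ℝ → ℝ} (h : HasNullclineExpansion k y) :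
    Tendsto y atBot (nhds 0) := by
  have h1 := h.trans_tendsto (tendsto_one_div_neg_pow_atBot (by omega))
  have h2 := (tendsto_one_div_neg_pow_atBot (n := k + 1) (by omega)).const_mul
    (1 / ((k : ℝ) + 2))
  simpa using h1.add h2

/-- After multiplication by (-u)^(k+1) the error tends to 0, so the positive leading coefficient
decides the sign. -/
theorem HasNullclineExpansion.eventually_pos {k : ℕ} {y : ℝ → ℝ}
    (h : HasNullclineExpansion k y) : ∀ᶠ u in atBot, 0 < y u := by
  have h1 : (fun u : ℝ => (y u - 1 / ((k : ℝ) + 2) * (1 / (-u) ^ (k + 1))) * (-u) ^ (k + 1))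
      =O[atBot] (fun u : ℝ => 1 / (-u) ^ (2 * k + 3)) := by
    refine (h.mul (isBigO_refl (fun u : ℝ => (-u) ^ (k + 1)) atBot)).congr' EventuallyEq.rfl ?_
    filter_upwards [eventually_lt_atBot 0] with u hu
    have : 0 < -u := by linarith
    generalize -u = t at *
    field_simp
    ring
  have h2 := h1.trans_tendsto (tendsto_one_div_neg_pow_atBot (by omega))
  have hk : -(1 / ((k : ℝ) + 2)) < 0 := by
    rw [neg_lt_zero]
    positivity
  filter_upwards [h2.eventually (lt_mem_nhds hk), eventually_lt_atBot 0] with u hu1 hu2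
  have ht : 0 < (-u) ^ (k + 1) := pow_pos (by linarith) _
  have h3 : (y u - 1 / ((k : ℝ) + 2) * (1 / (-u) ^ (k + 1))) * (-u) ^ (k + 1) =
      y u * (-u) ^ (k + 1) - 1 / ((k : ℝ) + 2) := by
    field_simp
  rw [h3] at hu1
  exact pos_of_mul_pos_left (by linarith) ht.le

theorem hasNullclineExpansion_of_bounds {k : ℕ} {y : ℝ → ℝ}
    (h1 : ∀ u ≤ 0, (k + 2) * (-u) ^ (k + 1) * y u ≤ 1)
    (h2 : ∀ u ≤ 0, (1 - (k + 2) * (-u) ^ (k + 1) * y u) * (-u) ^ (2 * k + 3) ≤ 1) :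
    HasNullclineExpansion k y := by
  refine IsBigO.of_bound 1 ?_
  filter_upwards [eventually_lt_atBot 0] with u hu
  have ht : 0 < -u := by linarith
  have h1 := h1 u hu.le
  have h2 := h2 u hu.le
  generalize y u = Y at *
  generalize -u = t at *
  have h3 : Y - 1 / ((k : ℝ) + 2) * (1 / t ^ (k + 1)) =
      -((1 - (k + 2) * t ^ (k + 1) * Y) / ((k + 2) * t ^ (k + 1))) := by
    field_simp
    ring
  rw [h3, norm_neg, one_mul, Real.norm_of_nonneg (div_nonneg (by linarith) (by positivity)),
    Real.norm_of_nonneg (by positivity), div_le_div_iff₀ (by positivity) (by positivity)]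
  have h4 : (1 - (k + 2) * t ^ (k + 1) * Y) * t ^ (3 * k + 4) =
      ((1 - (k + 2) * t ^ (k + 1) * Y) * t ^ (2 * k + 3)) * t ^ (k + 1) := by ring
  have h5 : 0 < t ^ (k + 1) := by positivity
  have hk : (0 : ℝ) ≤ k := k.cast_nonneg
  rw [h4]
  nlinarith [mul_le_mul_of_nonneg_right h2 h5.le, mul_nonneg hk h5.le]

theorem hasDerivWithinAt_add_neg_pow_iff {k : ℕ} {s : Set ℝ} {η : ℝ → ℝ} {u c : ℝ} :
    HasDerivWithinAt (fun u => η u + (-u) ^ (k + 2)) (c - (k + 2) * (-u) ^ (k + 1)) s u ↔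
      HasDerivWithinAt η c s u := by
  have hp := (hasDerivAt_neg_pow_succ (k + 1) u).hasDerivWithinAt (s := s)
  constructor <;> intro h
  · have h' := (h.sub hp).congr_deriv (g' := c) (by push_cast; ring)
    exact h'.congr_of_eventuallyEq (Eventually.of_forall fun x => by simp) (by simp)
  · refine (h.add hp).congr_deriv ?_
    push_cast
    ring

/-- The common form of the even and the odd case: `dη/du = 1 / (η + (-u) ^ (k + 2))`. -/
theorem exists_unique_slow_solution (k : ℕ) :
    ∃ η₀ : ℝ → ℝ, IsSolutionOn (fun u => (-u) ^ (k + 2)) (Set.Iic 0) η₀ ∧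
      HasNullclineExpansion k (fun u => η₀ u + (-u) ^ (k + 2)) ∧
      (∀ a : ℝ, a ≤ 0 → ∀ η : ℝ → ℝ, IsSolutionOn (fun u => (-u) ^ (k + 2)) (Set.Iic a) η →
        HasNullclineExpansion k (fun u => η u + (-u) ^ (k + 2)) →
          Set.EqOn η η₀ (Set.Iic a)) ∧
      (∀ u : ℝ, u ≤ 0 → 0 < η₀ u + (-u) ^ (k + 2)) ∧
      (∀ u : ℝ, u < 0 → η₀ u + (-u) ^ (k + 2) < 1 / (-u) ^ (k + 1)) := by
  obtain ⟨y, hy, h1, h2⟩ := exists_isReducedSolutionOn_Iic k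
  have hexp := hasNullclineExpansion_of_bounds h1 h2
  refine ⟨fun u => y u - (-u) ^ (k + 2), fun u hu => ?_, by simpa using hexp,
    fun a ha η hη hηexp => ?_, fun u hu => by simpa using (hy u hu).1, fun u hu => ?_⟩
  · rw [← hasDerivWithinAt_add_neg_pow_iff (k := k)]
    simp only [sub_add_cancel]
    exact ⟨(hy u hu).1.ne', (hy u hu).2⟩
  · have hcont : ContinuousOn (fun u => η u + (-u) ^ (k + 2)) (Set.Iic a) :=
      ContinuousOn.add (fun u hu => (hη u hu).2.continuousWithinAt) (by fun_prop)
    have hz : IsReducedSolutionOn k (Set.Iic a) (fun u => η u + (-u) ^ (k + 2)) := fun u hu => by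
      refine ⟨?_, hasDerivWithinAt_add_neg_pow_iff.2 (hη u hu).2⟩
      -- A competitor is positive near -∞ and never vanishes, so by the intermediate value theorem
      -- it is positive throughout.
      by_contra! hneg
      obtain ⟨v, hv1, hv2⟩ := (hηexp.eventually_pos.and (eventually_le_atBot u)).exists
      have hsub : Set.Icc v u ⊆ Set.Iic a := fun x hx => hx.2.trans hu
      obtain ⟨x, hx, hx0⟩ := intermediate_value_Icc' hv2 (hcont.mono hsub) ⟨hneg, hv1.le⟩
      exact (hη x (hsub hx)).1 hx0
    have heq := hz.eqOn (hy.mono (Set.Iic_subset_Iic.2 ha))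
      (by simpa using hηexp.tendsto.sub hexp.tendsto)
    exact fun u hu => eq_sub_of_add_eq (heq hu)
  · have ht : 0 < (-u) ^ (k + 1) := pow_pos (by linarith) _
    have hk : (0 : ℝ) ≤ k := k.cast_nonneg
    have h3 := mul_pos ht (hy u hu.le).1
    rw [sub_add_cancel, lt_div_iff₀ ht]
    nlinarith [h1 u hu.le, mul_nonneg hk h3.le]

/-! ### Translation by the parity of p -/

theorem hasEvenExpansion_iff {k : ℕ} (hk : Even k) {η : ℝ → ℝ} :
    HasEvenExpansion (k + 2) η ↔ HasNullclineExpansion k (fun u => η u + (-u) ^ (k + 2)) := by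
  unfold HasEvenExpansion HasNullclineExpansion
  have h1 : Even (k + 2) := hk.add even_two
  have h2 : Odd (k + 1) := hk.add_one
  have h3 : Even (3 * k + 4) := (hk.mul_left 3).add (by decide)
  rw [show 3 * (k + 2) - 2 = 3 * k + 4 by omega, show k + 2 - 1 = k + 1 by omega]
  simp only [h1.neg_pow, h2.neg_pow, h3.neg_pow]
  push_cast
  refine iff_of_eq (congrArg (fun f => f =O[atBot] _) (funext fun u => ?_))
  rw [one_div_neg_eq_neg_one_div]
  ring

theorem hasOddExpansion_iff {k : ℕ} (hk : Odd k) {η : ℝ → ℝ} :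
    HasOddExpansion (k + 2) η ↔ HasNullclineExpansion k (fun u => η u + (-u) ^ (k + 2)) := by
  unfold HasOddExpansion HasNullclineExpansion
  have h1 : Odd (k + 2) := hk.add_even even_two
  have h2 : Even (k + 1) := hk.add_one
  have h3 : Odd (3 * k + 4) := (Odd.mul (by decide) hk).add_even (by decide)
  rw [show 3 * (k + 2) - 2 = 3 * k + 4 by omega, show k + 2 - 1 = k + 1 by omega]
  simp only [h1.neg_pow, h2.neg_pow, h3.neg_pow, one_div_neg_eq_neg_one_div, isBigO_neg_right]
  push_cast
  refine iff_of_eq (congrArg (fun f => f =O[atBot] _) (funext fun u => ?_))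
  ring

theorem one_div_add_two_lt_one (k : ℕ) : 1 / ((k + 2 : ℕ) : ℝ) < 1 := by
  rw [div_lt_one (by positivity)]
  exact_mod_cast (by omega : 1 < k + 2)

theorem mainTheorem2 :
    (∀ p : ℕ, Even p → 2 ≤ p →
      ∃ η₀ : ℝ → ℝ,
        IsSolutionOn (fun u => u ^ p) (Set.Iic 0) η₀ ∧ HasEvenExpansion p η₀ ∧
        (∀ a : ℝ, a ≤ 0 → ∀ η : ℝ → ℝ,
          IsSolutionOn (fun u => u ^ p) (Set.Iic a) η → HasEvenExpansion p η →
            Set.EqOn η η₀ (Set.Iic a)) ∧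
        ∃ K : ℝ, 1 / (p : ℝ) < K ∧
          (∀ u : ℝ, u ≤ 0 → -u ^ p < η₀ u) ∧
          (∀ u : ℝ, u < 0 → η₀ u < -u ^ p - K / u ^ (p - 1))) ∧
    (∀ p : ℕ, Odd p → 3 ≤ p →
      ∃ η₀ : ℝ → ℝ,
        IsSolutionOn (fun u => -u ^ p) (Set.Iic 0) η₀ ∧ HasOddExpansion p η₀ ∧
        (∀ a : ℝ, a ≤ 0 → ∀ η : ℝ → ℝ,
          IsSolutionOn (fun u => -u ^ p) (Set.Iic a) η → HasOddExpansion p η →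
            Set.EqOn η η₀ (Set.Iic a)) ∧
        ∃ K : ℝ, 1 / (p : ℝ) < K ∧
          (∀ u : ℝ, u ≤ 0 → u ^ p < η₀ u) ∧
          (∀ u : ℝ, u < 0 → η₀ u < u ^ p + K / u ^ (p - 1))) := by
  refine ⟨fun p hp hp2 => ?_, fun p hp hp3 => ?_⟩
  · obtain ⟨k, rfl⟩ : ∃ k, p = k + 2 := ⟨p - 2, by omega⟩
    have hk : Even k := by simpa [Nat.even_add] using hp
    obtain ⟨η₀, h1, h2, h3, h4, h5⟩ := exists_unique_slow_solution k
    simp only [← hasEvenExpansion_iff hk] at h3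
    simp only [hp.neg_pow] at h1 h3 h4
    -- The nullcline bound allows any K > 1/p; K = 1 serves every p.
    refine ⟨η₀, h1, (hasEvenExpansion_iff hk).2 h2, h3, 1, one_div_add_two_lt_one k,
      fun u hu => by linarith [h4 u hu], fun u hu => ?_⟩
    have h6 := h5 u hu
    rw [hp.neg_pow, hk.add_one.neg_pow, one_div_neg_eq_neg_one_div] at h6
    rw [show k + 2 - 1 = k + 1 by omega]
    linarith
  · obtain ⟨k, rfl⟩ : ∃ k, p = k + 2 := ⟨p - 2, by omega⟩
    have hk : Odd k := by simpa [Nat.odd_add] using hp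
    obtain ⟨η₀, h1, h2, h3, h4, h5⟩ := exists_unique_slow_solution k
    simp only [← hasOddExpansion_iff hk] at h3
    simp only [hp.neg_pow] at h1 h3 h4
    refine ⟨η₀, h1, (hasOddExpansion_iff hk).2 h2, h3, 1, one_div_add_two_lt_one k,
      fun u hu => by linarith [h4 u hu], fun u hu => ?_⟩
    have h6 := h5 u hu
    rw [hp.neg_pow, hk.add_one.neg_pow] at h6
    rw [show k + 2 - 1 = k + 1 by omega]
    linarith
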